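/- Let $\mathbb{S}^2\subset\mathbb{R}^3$ be the unit sphere with its round metric $g_0$ and area measure $dv_{g_0}$, and let $I:\mathbb{S}^2\hookrightarrow\mathbb{R}^3$ be the inclusion. Let $\Omega\subset\mathbb{S}^2$ be a smooth domain (open, connected, lying locally on one side of its smooth boundary) with $\partial\Omega\neq\emptyset$, and let $\tilde g=e^{2w}g_0$, $w\in C^\infty(\mathbb{S}^2)$, be a metric conformal to $g_0$. Denote by $\mu=ds_{\tilde g}$ the length measure of $\partial\Omega$ with respect to $\tilde g$, and suppose that $$\int_{\mathbb{S}^2} I\,d\mu=0 .$$ Let $$\sigma_1=\sigma_1(\Omega,\tilde g)=\inf_{E}\ \sup_{0\ne f\in E}\frac{\int_\Omega|\nabla f|_{g_0}^2\,dv_{g_0}}{\int_{\partial\Omega} f^2\,d\mu}$$ be the first nontrivial Steklov eigenvalue, where $E$ ranges over the two-dimensional subspaces of $C^\infty(\overline\Omega)$ (the quotient being $+\infty$ if its denominator is zero), and let $\bar\sigma_1(\Omega,\tilde g)=\sigma_1\,\mu(\partial\Omega)$. Then the functional $$\varphi\mapsto \sigma_1\int_{\partial\Omega}\varphi\,d\mu-2\int_\Omega\varphi\,dv_{g_0}$$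 (with traces on $\partial\Omega$) is bounded on $W^{1,2}(\Omega,g_0)$, whose norm is $\|\varphi\|_{W^{1,2}}^2=\int_\Omega(\varphi^2+|\nabla\varphi|_{g_0}^2)\,dv_{g_0}$, and $$\bigl\|\sigma_1\mu-2\,dv_{g_0}\lfloor\Omega\bigr\|_{(W^{1,2}(\Omega,g_0))^*}^2+6\,\mathrm{Area}_{g_0}(\mathbb{S}^2\setminus\Omega)\le 3\bigl(8\pi-\bar\sigma_1(\Omega,\tilde g)\bigr).$$ -/

import Mathlib

open MeasureTheory Filter Topology
open scoped ENNReal ContDiff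

noncomputable section

namespace SteklovSphere

/-- Euclidean three-space. -/
abbrev E3 : Type := EuclideanSpace ℝ (Fin 3)

/-- The unit sphere in Euclidean three-space. -/
abbrev S2 : Type := Metric.sphere (0 : E3) 1

/-- The area measure of the round metric on the unit sphere (total mass `4 π`): the area of `A`
is three times the volume of the cone `{t x : 0 < t < 1, x ∈ A}`. -/
def area : Measure S2 := (volume : Measure E3).toSphere

/-- The gradient on the round sphere of (the restriction to the sphere of) `F`, i.e. the
projection of the Euclidean gradient to the tangent plane at `x`. -/
def tangentialGradient (F : E3 → ℝ) (x : S2) : E3 :=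
  gradient F (x : E3) - (inner ℝ (gradient F (x : E3)) (x : E3)) • (x : E3)

/-- `Ω` is a smooth domain in the sphere: open, connected (and nonempty), and near each boundary
point it is a strict sublevel set of a smooth function whose differential, along the sphere, does
not vanish at the point. -/
structure IsSmoothDomain (Ω : Set S2) : Prop where
  isOpen : IsOpen Ω
  isConnected : IsConnected Ω
  smooth_boundary : ∀ p ∈ frontier Ω, ∃ F : E3 → ℝ, ContDiff ℝ ∞ F ∧
    tangentialGradient F p ≠ 0 ∧ F (p : E3) = 0 ∧ ∀ᶠ x : S2 in 𝓝 p, x ∈ Ω ↔ F (x : E3) < 0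

/-- The length measure of `∂Ω` in the conformal metric `exp (2 w) g₀`, where `g₀` is the round
metric: lengths of curves are multiplied by the factor `exp w`. The measure `μH[1]` is length on
smooth curves. -/
def boundaryLength (Ω : Set S2) (w : E3 → ℝ) : Measure S2 :=
  ((Measure.hausdorffMeasure 1 : Measure S2).restrict (frontier Ω)).withDensity
    (fun x => ENNReal.ofReal (Real.exp (w (x : E3))))

/-- The Rayleigh quotient `∫_Ω |∇F|² dv / ∫ F² dμ`. It is `⊤` if the denominator vanishes and
the numerator does not. -/
def rayleigh (Ω : Set S2) (μ : Measure S2) (F : E3 → ℝ) : ℝ≥0∞ :=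
  (∫⁻ x in Ω, ENNReal.ofReal (‖tangentialGradient F x‖ ^ 2) ∂area) /
    ∫⁻ x, ENNReal.ofReal (F (x : E3) ^ 2) ∂μ

/-- `E` represents a subspace, of dimension `E.finrank`, of the space of smooth functions on the
compact surface `closure Ω`: smooth functions on `closure Ω` are restrictions of smooth functions
on the ambient space, and restriction to `closure Ω` is required to be injective on `E`. -/
def IsTestSpace (Ω : Set S2) (E : Submodule ℝ (E3 → ℝ)) : Prop :=
  (∀ F ∈ E, ContDiff ℝ ∞ F) ∧ ∀ F ∈ E, (∀ x ∈ closure Ω, F (x : E3) = 0) → F = 0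

/-- The `k`-th variational eigenvalue (counted from `k = 0`) of the measure `μ` on `closure Ω`,
with respect to the conformal class of the round metric: the infimum over all
`(k + 1)`-dimensional spaces of smooth functions of the largest Rayleigh quotient. The Dirichlet
energy is conformally invariant in dimension two, so it is computed in the round metric. -/
def eigenvalue (Ω : Set S2) (μ : Measure S2) (k : ℕ) : ℝ≥0∞ :=
  ⨅ (E : Submodule ℝ (E3 → ℝ)) (_ : IsTestSpace Ω E ∧ Module.finrank ℝ E = k + 1),
    ⨆ (F : E3 → ℝ) (_ : F ∈ E ∧ F ≠ 0), rayleigh Ω μ F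

/-- The first nontrivial Steklov eigenvalue of `Ω` with the metric `exp (2 w) g₀`. -/
def sigmaOne (Ω : Set S2) (w : E3 → ℝ) : ℝ :=
  (eigenvalue Ω (boundaryLength Ω w) 1).toReal

/-- The total boundary length of `Ω` in the metric `exp (2 w) g₀`. -/
def totalLength (Ω : Set S2) (w : E3 → ℝ) : ℝ :=
  (boundaryLength Ω w).real Set.univ

/-- The length-normalized first Steklov eigenvalue of `Ω` with the metric `exp (2 w) g₀`. -/
def sigmaOneBar (Ω : Set S2) (w : E3 → ℝ) : ℝ :=
  sigmaOne Ω w * totalLength Ω w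

/-- `φ` belongs to `W^{1,2}(Ω, g₀)`, with gradient `G`, and `τ` is its image under the extension
to `W^{1,2}(Ω, g₀)` of the identity map from smooth functions to `L²(μ)` (its trace, if `μ` is a
length measure on the boundary). The Sobolev space is the completion of the smooth functions on
`closure Ω` in the `W^{1,2}` norm. -/
structure IsSobolev (Ω : Set S2) (μ : Measure S2) (φ : S2 → ℝ) (G : S2 → E3) (τ : S2 → ℝ) :
    Prop where
  memLp : MemLp φ 2 (area.restrict Ω)
  memLp_grad : MemLp G 2 (area.restrict Ω)
  memLp_trace : MemLp τ 2 μ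
  approx : ∃ F : ℕ → E3 → ℝ, (∀ n, ContDiff ℝ ∞ (F n)) ∧
    Tendsto (fun n => eLpNorm (fun x : S2 => F n (x : E3) - φ x) 2 (area.restrict Ω))
      atTop (𝓝 0) ∧
    Tendsto (fun n => eLpNorm (fun x : S2 => tangentialGradient (F n) x - G x) 2
      (area.restrict Ω)) atTop (𝓝 0) ∧
    Tendsto (fun n => eLpNorm (fun x : S2 => F n (x : E3) - τ x) 2 μ) atTop (𝓝 0)

/-- The norm `‖a μ - b dv_{g₀}⌊Ω‖` in the dual of `W^{1,2}(Ω, g₀)`: the supremum of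
`|a ∫ φ dμ - b ∫_Ω φ dv|` over all `φ` in `W^{1,2}(Ω, g₀)` with
`∫_Ω φ² dv + ∫_Ω |∇φ|² dv ≤ 1`, where `φ` is integrated against `μ` through its trace. -/
def sobolevDualNorm (Ω : Set S2) (μ : Measure S2) (a b : ℝ) : ℝ≥0∞ :=
  ⨆ (φ : S2 → ℝ) (G : S2 → E3) (τ : S2 → ℝ)
    (_ : IsSobolev Ω μ φ G τ ∧
      eLpNorm φ 2 (area.restrict Ω) ^ 2 + eLpNorm G 2 (area.restrict Ω) ^ 2 ≤ 1),
    ENNReal.ofReal |a * (∫ x, τ x ∂μ) - b * (∫ x in Ω, φ x ∂area)|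

end SteklovSphere

end

namespace SteklovSphere

/-! ### Finiteness of the boundary length -/

/-! The argument perturbs Hersch's method. By balancing, the coordinates `xᵢ` have `μ`-mean zero;
for smooth `F` and real `t` so do `hᵢ = (1 + tF)xᵢ - t cᵢ`, once `cᵢ` is the `μ`-mean of `F xᵢ`.
Each `hᵢ` is thus admissible for `σ₁`. Since `∑ xᵢ² = 1`, summing over `i` gives total energy `∫_Ω
2(1 + tF)² + t²|∇F|²`, while `∑ ∫ hᵢ² dμ ≥ ∫ (1 + 2tF) dμ`.

The resulting inequality says that a quadratic in `t` is nonnegative. Its constant term is the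
defect `S = 2 Area(Ω) - σ̄₁`, so `S ≥ 0`, and its discriminant gives `(σ₁∫F dμ - 2∫_Ω F)² ≤ S(2∫_Ω
F² + ∫_Ω |∇F|²) ≤ 2S‖F‖²` (`quadratic_nonneg_of_balanced`, `sq_pairing_le`). Density extends this to
the Sobolev space, so the squared dual norm is at most `2S ≤ 3S`, and `3S + 6 Area(Ωᶜ) = 3(8π -
σ̄₁)` because the sphere has area `4π`.

All of this needs `μ` to be finite, which follows from compactness of `∂Ω` and a local bi-Lipschitz
parametrization. -/

theorem hausdorffMeasure_lt_top_of_dist_le {X : Type*} [MetricSpace X] [MeasurableSpace X]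
    [BorelSpace X] {s : Set X} {f : X → ℝ} {K : NNReal} {R : ℝ}
    (hf : ∀ x ∈ s, ∀ y ∈ s, dist x y ≤ K * dist (f x) (f y)) (hR : ∀ x ∈ s, |f x| ≤ R) :
    (Measure.hausdorffMeasure 1 : Measure X) s < ⊤ := by
  have h1 : AntilipschitzWith K (fun x : s => f x) :=
    AntilipschitzWith.of_le_mul_dist fun x y => hf x x.2 y y.2
  have h2 := h1.hausdorffMeasure_preimage_le (d := 1) zero_le_one (Set.Icc (-R) R)
  have h3 : (fun x : s => f x) ⁻¹' (Set.Icc (-R) R) = Set.univ := by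
    ext x
    simpa using abs_le.mp (hR x x.2)
  have h4 := (isometry_subtype_coe (s := s)).hausdorffMeasure_image (d := 1)
    (Or.inl zero_le_one) Set.univ
  rw [Set.image_univ, Subtype.range_coe] at h4
  rw [h4, ← h3]
  refine h2.trans_lt ?_
  rw [hausdorffMeasure_real, Real.volume_Icc]
  exact ENNReal.mul_lt_top (by simp) (by simp)

/-- The hypothesis makes `p` and `g` independent, so the orthogonal complement of their span is a
line; `e` is a generator of it, the tangent direction of the boundary curve at `p`. -/
theorem exists_unit_normal {g p : E3} (hp : ‖p‖ = 1) (hg : g - (inner ℝ g p) • p ≠ 0) :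
    ∃ e : E3, ∀ v : E3, inner ℝ g v = 0 → inner ℝ p v = 0 → inner ℝ e v = 0 → v = 0 := by
  have hp0 : p ≠ 0 := by
    rintro rfl
    simp at hp
  have hli : LinearIndependent ℝ ![p, g] := by
    rw [LinearIndependent.pair_iff' hp0]
    rintro a rfl
    apply hg
    rw [real_inner_smul_left, real_inner_self_eq_norm_sq, hp]
    simp
  set W : Submodule ℝ E3 := Submodule.span ℝ (Set.range ![p, g]) with hW
  have hr : Module.finrank ℝ W = 2 := by
    simpa using finrank_span_eq_card hli
  have hr' : Module.finrank ℝ Wᗮ = 1 := by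
    have := W.finrank_add_finrank_orthogonal
    rw [hr, finrank_euclideanSpace_fin] at this
    omega
  obtain ⟨e, -, he⟩ := finrank_eq_one_iff'.mp hr'
  refine ⟨e, fun v h1 h2 h3 => ?_⟩
  have hv : v ∈ Wᗮ := by
    rw [hW, Submodule.mem_orthogonal]
    intro u hu
    induction hu using Submodule.span_induction with
    | mem x hx =>
      obtain ⟨i, rfl⟩ := hx
      fin_cases i
      · exact h2
      · exact h1
    | zero => simp
    | add x y _ _ hx hy => rw [inner_add_left, hx, hy, add_zero]
    | smul a x _ hx => rw [real_inner_smul_left, hx, mul_zero]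
  obtain ⟨c, hc⟩ := he ⟨v, hv⟩
  have hc' : c • (e : E3) = v := congrArg Subtype.val hc
  have : inner ℝ v v = 0 := by
    nth_rewrite 1 [← hc']
    rw [real_inner_smul_left, h3, mul_zero]
  exact inner_self_eq_zero.mp this

/-- An injective linear map in finite dimension satisfies `‖v‖ ≤ K‖Av‖`. Where `H` differs from `A`
by a `1/(2K)`-Lipschitz error, that error absorbs only half of `‖x - y‖`. -/
theorem exists_antilipschitz_nhds {E F : Type*} [NormedAddCommGroup E] [NormedSpace ℝ E]
    [FiniteDimensional ℝ E] [NormedAddCommGroup F] [NormedSpace ℝ F] {H : E → F} {A : E →L[ℝ] F}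
    {p : E} (hH : HasStrictFDerivAt H A p) (hA : ∀ v, A v = 0 → v = 0) :
    ∃ K : NNReal, ∃ U ∈ 𝓝 p, ∀ x ∈ U, ∀ y ∈ U, dist x y ≤ K * dist (H x) (H y) := by
  obtain ⟨K, hK, hAK⟩ := LinearMap.exists_antilipschitzWith (A : E →ₗ[ℝ] F)
    (LinearMap.ker_eq_bot'.mpr hA)
  have hK' : (0 : ℝ) < K := hK
  have hc : (0 : NNReal) < (2 * K)⁻¹ := by positivity
  obtain ⟨U, hU, hUA⟩ := hH.approximates_deriv_on_nhds (c := (2 * K)⁻¹) (Or.inr hc)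
  refine ⟨2 * K, U, hU, fun x hx y hy => ?_⟩
  have h1 := hUA x hx y hy
  have h2 := hAK.le_mul_dist x y
  rw [dist_eq_norm, dist_eq_norm] at h2 ⊢
  have h3 : ‖A (x - y)‖ ≤ ‖H x - H y‖ + ‖H x - H y - A (x - y)‖ := by
    have := norm_sub_le (H x - H y) (H x - H y - A (x - y))
    simpa using this
  have h4 : (A : E →ₗ[ℝ] F) x - (A : E →ₗ[ℝ] F) y = A (x - y) := by simp
  rw [h4] at h2
  push_cast at h1 ⊢
  have h5 : ‖x - y‖ ≤ K * (‖H x - H y‖ + (2 * (K : ℝ))⁻¹ * ‖x - y‖) :=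
    h2.trans (by gcongr; linarith)
  have h6 : (K : ℝ) * (‖H x - H y‖ + (2 * (K : ℝ))⁻¹ * ‖x - y‖)
      = K * ‖H x - H y‖ + ‖x - y‖ / 2 := by
    field_simp
  linarith

/-- The map `x ↦ (F x, ‖x‖², ⟨e, x⟩)` has injective derivative at `p`. On the zero set of `F` in the
sphere its first two components are constant, so `⟨e, x⟩` alone controls distances there. -/
theorem exists_nhds_hausdorffMeasure_lt_top {F : E3 → ℝ} (hF : ContDiff ℝ ∞ F) {p : S2}
    (hg : tangentialGradient F p ≠ 0) :
    ∃ U ∈ 𝓝 p, (Measure.hausdorffMeasure 1 : Measure S2) (U ∩ {x | F (x : E3) = 0}) < ⊤ := by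
  obtain ⟨e, he⟩ := exists_unit_normal (norm_eq_of_mem_sphere p) hg
  have h1 : HasStrictFDerivAt F (fderiv ℝ F p) p :=
    hF.contDiffAt.hasStrictFDerivAt (by simp)
  have h2 : HasStrictFDerivAt (fun x : E3 => ‖x‖ ^ 2) (2 • innerSL ℝ (p : E3)) (p : E3) :=
    hasStrictFDerivAt_norm_sq _
  have h3 : HasStrictFDerivAt (fun x : E3 => innerSL ℝ e x) (innerSL ℝ e) (p : E3) :=
    (innerSL ℝ e).hasStrictFDerivAt
  obtain ⟨K, V, hV, hVK⟩ := exists_antilipschitz_nhds (h1.prodMk (h2.prodMk h3)) (by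
    intro v hv
    simp only [ContinuousLinearMap.prod_apply, Prod.mk_eq_zero] at hv
    refine he v ?_ ?_ (by simpa using hv.2.2)
    · rw [inner_gradient_left]
      exact hv.1
    · simpa using hv.2.1)
  refine ⟨(fun x : S2 => (x : E3)) ⁻¹' V, continuous_subtype_val.continuousAt hV, ?_⟩
  refine hausdorffMeasure_lt_top_of_dist_le (f := fun x : S2 => inner ℝ e (x : E3)) (K := K)
    (R := ‖e‖) ?_ ?_
  · rintro x ⟨hx, hx0⟩ y ⟨hy, hy0⟩
    have := hVK x hx y hy
    change F x = 0 at hx0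
    change F y = 0 at hy0
    simpa [Subtype.dist_eq, Prod.dist_eq, hx0, hy0] using this
  · intro x _
    simpa using abs_real_inner_le_norm e (x : E3)

theorem IsSmoothDomain.hausdorffMeasure_frontier_lt_top {Ω : Set S2} (hΩ : IsSmoothDomain Ω) :
    (Measure.hausdorffMeasure 1 : Measure S2) (frontier Ω) < ⊤ := by
  refine (isClosed_frontier.isCompact).measure_lt_top_of_nhdsWithin fun p hp => ?_
  obtain ⟨F, hF, hg, -, hloc⟩ := hΩ.smooth_boundary p hp
  obtain ⟨U, hU, hUF⟩ := exists_nhds_hausdorffMeasure_lt_top hF hg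
  obtain ⟨V, hVΩ, hVo, hpV⟩ := eventually_nhds_iff.mp hloc
  have hFc : Continuous fun x : S2 => F (x : E3) := hF.continuous.comp continuous_subtype_val
  refine ⟨frontier Ω ∩ (U ∩ V), ?_, (measure_mono ?_).trans_lt hUF⟩
  · exact inter_mem self_mem_nhdsWithin
      (mem_nhdsWithin_of_mem_nhds (inter_mem hU (hVo.mem_nhds hpV)))
  · rintro x ⟨hx, hxU, hxV⟩
    -- `F ≤ 0` because `x` is a limit of points of `Ω` near `p`; `F ≥ 0` because `Ω` is open and so
    -- misses its frontier.
    refine ⟨hxU, le_antisymm ?_ ?_⟩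
    · have hx' : x ∈ closure (V ∩ Ω) :=
        hVo.inter_closure ⟨hxV, frontier_subset_closure hx⟩
      refine closure_minimal (t := {x : S2 | F (x : E3) ≤ 0}) ?_
        (isClosed_le hFc continuous_const) hx'
      rintro y ⟨hyV, hyΩ⟩
      exact ((hVΩ y hyV).mp hyΩ).le
    · rw [hΩ.isOpen.frontier_eq] at hx
      exact not_lt.mp fun h => hx.2 ((hVΩ x hxV).mpr h)

theorem IsSmoothDomain.isFiniteMeasure_boundaryLength {Ω : Set S2} (hΩ : IsSmoothDomain Ω)
    {w : E3 → ℝ} (hw : ContDiff ℝ ∞ w) : IsFiniteMeasure (boundaryLength Ω w) := by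
  have : IsFiniteMeasure ((Measure.hausdorffMeasure 1 : Measure S2).restrict (frontier Ω)) :=
    ⟨by simpa using hΩ.hausdorffMeasure_frontier_lt_top⟩
  have hc : Continuous fun x : S2 => Real.exp (w (x : E3)) :=
    Real.continuous_exp.comp (hw.continuous.comp continuous_subtype_val)
  have hi : Integrable (fun x : S2 => Real.exp (w (x : E3)))
      ((Measure.hausdorffMeasure 1 : Measure S2).restrict (frontier Ω)) :=
    hc.integrable_of_hasCompactSupport (HasCompactSupport.of_compactSpace _)
  exact isFiniteMeasure_withDensity_ofReal hi.2

theorem boundaryLength_compl_closure (Ω : Set S2) (w : E3 → ℝ) :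
    boundaryLength Ω w (closure Ω)ᶜ = 0 := by
  refine withDensity_absolutelyContinuous _ _ ?_
  rw [Measure.restrict_apply isClosed_closure.isOpen_compl.measurableSet]
  have : (closure Ω)ᶜ ∩ frontier Ω = ∅ := by
    ext x
    simpa using fun h h' => h (frontier_subset_closure h')
  rw [this, measure_empty]

end SteklovSphere

namespace SteklovSphere

/-! ### Calculus of the tangential gradient -/

theorem tangentialGradient_eq_of_hasGradientAt {F : E3 → ℝ} {x : S2} {g : E3}
    (h : HasGradientAt F g (x : E3)) :
    tangentialGradient F x = g - (inner ℝ g (x : E3)) • (x : E3) := by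
  rw [tangentialGradient, h.gradient]

theorem hasGradientAt_coord (i : Fin 3) (x : E3) :
    HasGradientAt (fun y : E3 => y i) (EuclideanSpace.single i (1 : ℝ)) x := by
  rw [hasGradientAt_iff_hasFDerivAt]
  have := (EuclideanSpace.proj i : E3 →L[ℝ] ℝ).hasFDerivAt (x := x)
  convert! this using 1
  ext v
  simp [EuclideanSpace.inner_single_left]

theorem tangentialGradient_affine_mul_coord {F : E3 → ℝ} {x : S2}
    (hF : DifferentiableAt ℝ F (x : E3)) (t c : ℝ) (i : Fin 3) :
    tangentialGradient (fun y => (1 + t * F y) * y i - c) x =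
      (1 + t * F x) • (EuclideanSpace.single i (1 : ℝ) - (x : E3) i • (x : E3))
        + (t * (x : E3) i) • tangentialGradient F x := by
  have h : HasGradientAt (fun y : E3 => (1 + t * F y) * y i - c)
      ((1 + t * F x) • EuclideanSpace.single i (1 : ℝ)
        + (t * (x : E3) i) • gradient F (x : E3)) (x : E3) := by
    rw [hasGradientAt_iff_hasFDerivAt]
    have h1 := hF.hasGradientAt.hasFDerivAt
    have h2 := (hasGradientAt_coord i (x : E3)).hasFDerivAt
    convert! (((h1.const_mul t).const_add 1).mul h2).sub_const c using 1
    ext v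
    simp
    ring
  rw [tangentialGradient_eq_of_hasGradientAt h, tangentialGradient]
  simp only [inner_add_left, real_inner_smul_left, EuclideanSpace.inner_single_left, map_one,
    one_mul]
  module

theorem tangentialGradient_add_const_mul {F : E3 → ℝ} {x : S2}
    (hF : DifferentiableAt ℝ F (x : E3)) (a b : ℝ) :
    tangentialGradient (fun y => a + b * F y) x = b • tangentialGradient F x := by
  have h : HasGradientAt (fun y : E3 => a + b * F y) (b • gradient F (x : E3)) (x : E3) := by
    rw [hasGradientAt_iff_hasFDerivAt]
    convert! ((hF.hasGradientAt.hasFDerivAt.const_mul b).const_add a) using 1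
    simp
  rw [tangentialGradient_eq_of_hasGradientAt h, tangentialGradient, real_inner_smul_left]
  module

theorem sum_coord_sq (x : S2) : ∑ i, (x : E3) i ^ 2 = 1 := by
  rw [← EuclideanSpace.real_norm_sq_eq, norm_eq_of_mem_sphere, one_pow]

/-- For the coordinate functions `xᵢ`, `∑ |∇((1 + t F) xᵢ)|² = 2 (1 + t F)² + t² |∇F|²`. -/
theorem sum_norm_sq_tangentialGradient {F : E3 → ℝ} {x : S2}
    (hF : DifferentiableAt ℝ F (x : E3)) (t : ℝ) (c : Fin 3 → ℝ) :
    ∑ i, ‖tangentialGradient (fun y => (1 + t * F y) * y i - c i) x‖ ^ 2 =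
      2 * (1 + t * F x) ^ 2 + t ^ 2 * ‖tangentialGradient F x‖ ^ 2 := by
  have h1 := sum_coord_sq x
  simp only [fun i => tangentialGradient_affine_mul_coord hF t (c i) i]
  -- Tangency of `G` is not needed: the cross terms sum to a multiple of `⟨x, G⟩(1 - |x|²)`, which
  -- vanishes on the sphere.
  generalize tangentialGradient F x = G
  generalize F x = f
  simp only [Fin.sum_univ_three] at h1
  obtain ⟨x, hx⟩ := x
  simp only [EuclideanSpace.real_norm_sq_eq, Fin.sum_univ_three]
  simp
  linear_combination ((1 + t * f) ^ 2 * (x 0 ^ 2 + x 1 ^ 2 + x 2 ^ 2 - 1)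
    + t ^ 2 * (G 0 ^ 2 + G 1 ^ 2 + G 2 ^ 2)
    - 2 * (1 + t * f) * t * (x 0 * G 0 + x 1 * G 1 + x 2 * G 2)) * h1

theorem continuous_tangentialGradient {F : E3 → ℝ} (hF : ContDiff ℝ ∞ F) :
    Continuous (tangentialGradient F) := by
  have h : Continuous (gradient F) :=
    (InnerProductSpace.toDual ℝ E3).symm.continuous.comp (hF.continuous_fderiv (by simp))
  have h' : Continuous fun x : S2 => gradient F (x : E3) := h.comp continuous_subtype_val
  unfold tangentialGradient
  fun_prop

theorem integrable_of_continuous {μ : Measure S2} [IsFiniteMeasure μ] {E : Type*}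
    [NormedAddCommGroup E] {f : S2 → E} (hf : Continuous f) : Integrable f μ :=
  hf.integrable_of_hasCompactSupport (HasCompactSupport.of_compactSpace _)

theorem memLp_two_of_continuous {μ : Measure S2} [IsFiniteMeasure μ] {E : Type*}
    [NormedAddCommGroup E] {f : S2 → E} (hf : Continuous f) : MemLp f 2 μ :=
  hf.memLp_of_hasCompactSupport (HasCompactSupport.of_compactSpace _)

instance : IsFiniteMeasure area := inferInstanceAs (IsFiniteMeasure (volume : Measure E3).toSphere)

theorem area_real_univ : area.real Set.univ = 4 * Real.pi := by
  rw [area, Measure.toSphere_real_apply_univ, Measure.real, EuclideanSpace.volume_ball_fin_three]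
  have : (0 : ℝ) ≤ Real.pi * 4 / 3 := by positivity
  simp [ENNReal.toReal_ofReal this]
  ring

/-! ### The variational inequality for mean-zero functions -/

/-- The test space is the span of `1` and `u`. Mean zero kills the cross term in `∫ (a + bu)² dμ`,
and the constant adds no energy, so `u` itself has the largest quotient. -/
theorem eigenvalue_one_mul_integral_sq_le {Ω : Set S2} {μ : Measure S2} [IsFiniteMeasure μ]
    (hμ : μ (closure Ω)ᶜ = 0) {u : E3 → ℝ} (hu : ContDiff ℝ ∞ u)
    (h0 : ∫ x : S2, u x ∂μ = 0) :
    (eigenvalue Ω μ 1).toReal * ∫ x : S2, u x ^ 2 ∂μ ≤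
      ∫ x in Ω, ‖tangentialGradient u x‖ ^ 2 ∂area := by
  set D := ∫ x in Ω, ‖tangentialGradient u x‖ ^ 2 ∂area with hD
  set N := ∫ x : S2, u x ^ 2 ∂μ with hN
  have hD0 : 0 ≤ D := integral_nonneg fun _ => by positivity
  have hN0 : 0 ≤ N := integral_nonneg fun _ => by positivity
  rcases hN0.eq_or_lt with hN' | hNpos
  · rw [← hN', mul_zero]
    exact hD0
  have huc : Continuous fun x : S2 => u (x : E3) := hu.continuous.comp continuous_subtype_val
  have hgc := continuous_tangentialGradient hu
  have hint : ∀ a b : ℝ, ∫ x : S2, (a + b * u x) ^ 2 ∂μ = a ^ 2 * μ.real Set.univ + b ^ 2 * N := by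
    intro a b
    have h1 : ∀ x : S2, (a + b * u x) ^ 2 = (a ^ 2 + (2 * a * b) * u x) + b ^ 2 * u x ^ 2 :=
      fun x => by ring
    simp_rw [h1]
    rw [integral_add (integrable_of_continuous (by fun_prop))
        (integrable_of_continuous (by fun_prop)),
      integral_add (integrable_of_continuous (by fun_prop))
        (integrable_of_continuous (by fun_prop)),
      integral_const_mul, integral_const_mul, h0, integral_const, smul_eq_mul]
    ring
  have hM : 0 < μ.real Set.univ := by
    rw [measureReal_def, ENNReal.toReal_pos_iff]
    refine ⟨pos_iff_ne_zero.mpr fun h => ?_, measure_lt_top _ _⟩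
    rw [Measure.measure_univ_eq_zero] at h
    simp [hN, h] at hNpos
  -- Independence must hold on `closure Ω`, not just on the ambient space; it does because `μ` lives
  -- there and sees both `1` and `u`.
  have hker : ∀ a b : ℝ, (∀ x ∈ closure Ω, a + b * u (x : E3) = 0) → a = 0 ∧ b = 0 := by
    intro a b hab
    have h1 : ∫ x : S2, (a + b * u x) ^ 2 ∂μ = 0 := by
      refine integral_eq_zero_of_ae ?_
      filter_upwards [compl_mem_ae_iff.mpr hμ] with x hx
      simp only [compl_compl] at hx
      simp [hab x hx]
    rw [hint] at h1
    have h2 : 0 ≤ a ^ 2 * μ.real Set.univ := by positivity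
    have h3 : 0 ≤ b ^ 2 * N := by positivity
    have h4 : a ^ 2 * μ.real Set.univ = 0 := by linarith
    have h5 : b ^ 2 * N = 0 := by linarith
    exact ⟨by simpa [hM.ne'] using h4, by simpa [hNpos.ne'] using h5⟩
  set E : Submodule ℝ (E3 → ℝ) := Submodule.span ℝ (Set.range ![(fun _ => 1), u]) with hE
  have hmem : ∀ F ∈ E, ∃ a b : ℝ, F = fun y => a + b * u y := by
    intro F hF
    rw [hE, Matrix.range_cons_cons_empty, Submodule.mem_span_pair] at hF
    obtain ⟨a, b, rfl⟩ := hF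
    exact ⟨a, b, by ext y; simp⟩
  have htest : IsTestSpace Ω E := by
    refine ⟨fun F hF => ?_, fun F hF hF0 => ?_⟩
    · obtain ⟨a, b, rfl⟩ := hmem F hF
      fun_prop
    · obtain ⟨a, b, rfl⟩ := hmem F hF
      obtain ⟨rfl, rfl⟩ := hker a b hF0
      ext y
      simp
  have hrank : Module.finrank ℝ E = 1 + 1 := by
    have hli : LinearIndependent ℝ ![(fun _ : E3 => (1 : ℝ)), u] := by
      rw [LinearIndependent.pair_iff]
      intro a b hab
      exact hker a b fun x _ => by simpa using congrFun hab (x : E3)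
    simpa using finrank_span_eq_card hli
  have hle : eigenvalue Ω μ 1 ≤ ENNReal.ofReal (D / N) := by
    refine (iInf₂_le E ⟨htest, by simpa using hrank⟩).trans (iSup₂_le fun F hF => ?_)
    obtain ⟨a, b, rfl⟩ := hmem F hF.1
    refine ENNReal.div_le_of_le_mul ?_
    have hsm : ContDiff ℝ ∞ fun y => a + b * u y := by fun_prop
    rw [← ofReal_integral_eq_lintegral_ofReal
        (f := fun x : S2 => ‖tangentialGradient (fun y => a + b * u y) x‖ ^ 2)
        (integrable_of_continuous ((continuous_tangentialGradient hsm).norm.pow 2))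
        (.of_forall fun _ => by positivity),
      ← ofReal_integral_eq_lintegral_ofReal (f := fun x : S2 => (a + b * u x) ^ 2) ?_
        (.of_forall fun _ => by positivity),
      ← ENNReal.ofReal_mul (by positivity), hint]
    · refine ENNReal.ofReal_le_ofReal ?_
      have h1 : ∀ x : S2, ‖tangentialGradient (fun y => a + b * u y) x‖ ^ 2
          = b ^ 2 * ‖tangentialGradient u x‖ ^ 2 := fun x => by
        rw [tangentialGradient_add_const_mul (hu.differentiable (by simp) _), norm_smul, mul_pow,
          Real.norm_eq_abs, sq_abs]
      simp_rw [h1]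
      rw [integral_const_mul, ← hD]
      have h2 : D / N * (a ^ 2 * μ.real Set.univ + b ^ 2 * N)
          = D / N * (a ^ 2 * μ.real Set.univ) + b ^ 2 * D := by
        field_simp
      have h3 : 0 ≤ D / N * (a ^ 2 * μ.real Set.univ) := by positivity
      linarith
    · exact integrable_of_continuous (by fun_prop)
  have := ENNReal.toReal_le_of_le_ofReal (by positivity) hle
  calc _ ≤ D / N * N := by gcongr
    _ = D := by field_simp

end SteklovSphere

namespace SteklovSphere

/-! ### The dual estimate for smooth functions -/

theorem contDiff_affine_mul_coord {F : E3 → ℝ} (hF : ContDiff ℝ ∞ F) (t c : ℝ) (i : Fin 3) :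
    ContDiff ℝ ∞ (fun y : E3 => (1 + t * F y) * y i - c) := by
  fun_prop

theorem quadratic_nonneg_of_balanced {Ω : Set S2} {μ : Measure S2} [IsFiniteMeasure μ]
    (hμ : μ (closure Ω)ᶜ = 0) (hbal : ∀ i, ∫ x : S2, (x : E3) i ∂μ = 0)
    {F : E3 → ℝ} (hF : ContDiff ℝ ∞ F) (t : ℝ) :
    0 ≤ (2 * ∫ x in Ω, F (x : E3) ^ 2 ∂area + ∫ x in Ω, ‖tangentialGradient F x‖ ^ 2 ∂area)
        * (t * t)
      + (2 * (2 * ∫ x in Ω, F (x : E3) ∂area - (eigenvalue Ω μ 1).toReal * ∫ x : S2, F x ∂μ)) * t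
      + (2 * area.real Ω - (eigenvalue Ω μ 1).toReal * μ.real Set.univ) := by
  have hFc : Continuous fun x : S2 => F (x : E3) := hF.continuous.comp continuous_subtype_val
  have hgc := continuous_tangentialGradient hF
  -- `c i` is the `μ`-mean of `F xᵢ`; if `μ = 0` any value serves.
  obtain ⟨c, hc⟩ : ∃ c : Fin 3 → ℝ, ∀ i, c i * μ.real Set.univ = ∫ x : S2, F x * (x : E3) i ∂μ := by
    rcases eq_or_ne (μ.real Set.univ) 0 with h | h
    · have h' : μ = 0 := by
        simpa [measureReal_def, ENNReal.toReal_eq_zero_iff] using h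
      exact ⟨0, fun i => by simp [h']⟩
    · exact ⟨fun i => (∫ x : S2, F x * (x : E3) i ∂μ) / μ.real Set.univ,
        fun i => div_mul_cancel₀ _ h⟩
  set h : Fin 3 → E3 → ℝ := fun i y => (1 + t * F y) * y i - t * c i with hh
  have hsm : ∀ i, ContDiff ℝ ∞ (h i) := fun i => contDiff_affine_mul_coord hF t (t * c i) i
  have hcont : ∀ i, Continuous fun x : S2 => h i (x : E3) := fun i =>
    (hsm i).continuous.comp continuous_subtype_val
  have hzero : ∀ i, ∫ x : S2, h i x ∂μ = 0 := by
    intro i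
    have h1 : ∀ x : S2, h i x = (x : E3) i + t * (F x * (x : E3) i) - t * c i := fun x => by
      simp only [hh]; ring
    simp_rw [h1]
    rw [integral_sub (integrable_of_continuous (by fun_prop))
        (integrable_of_continuous (by fun_prop)),
      integral_add (integrable_of_continuous (by fun_prop))
        (integrable_of_continuous (by fun_prop)),
      integral_const_mul, hbal, ← hc, integral_const, smul_eq_mul]
    ring
  have hvar : (eigenvalue Ω μ 1).toReal * ∑ i, ∫ x : S2, h i x ^ 2 ∂μ ≤
      ∑ i, ∫ x in Ω, ‖tangentialGradient (h i) x‖ ^ 2 ∂area := by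
    rw [Finset.mul_sum]
    exact Finset.sum_le_sum fun i _ => eigenvalue_one_mul_integral_sq_le hμ (hsm i) (hzero i)
  -- Write `hᵢ = xᵢ + t(F xᵢ - cᵢ)`, expand and drop the last square; balancing removes the terms
  -- linear in `xᵢ`.
  have hlower : μ.real Set.univ + 2 * t * ∫ x : S2, F x ∂μ ≤ ∑ i, ∫ x : S2, h i x ^ 2 ∂μ := by
    rw [← integral_finsetSum _ fun i _ =>
      integrable_of_continuous (f := fun x : S2 => h i x ^ 2) ((hcont i).pow 2)]
    have h1 : ∫ x : S2, ((1 + 2 * t * F x) - ∑ i, 2 * t * c i * (x : E3) i) ∂μ =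
        μ.real Set.univ + 2 * t * ∫ x : S2, F x ∂μ := by
      rw [integral_sub (integrable_of_continuous (by fun_prop))
          (integrable_of_continuous (by fun_prop)),
        integral_add (integrable_of_continuous (by fun_prop))
          (integrable_of_continuous (by fun_prop)),
        integral_finsetSum _ fun i _ => integrable_of_continuous (by fun_prop)]
      simp_rw [integral_const_mul, hbal]
      simp
    rw [← h1]
    refine integral_mono (integrable_of_continuous (by fun_prop))
      (integrable_of_continuous (by fun_prop)) fun x => ?_
    have h2 : (1 + 2 * t * F x) - ∑ i, 2 * t * c i * (x : E3) i =
        ∑ i, ((1 + 2 * t * F x) * (x : E3) i ^ 2 - 2 * t * c i * (x : E3) i) := by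
      rw [Finset.sum_sub_distrib, ← Finset.mul_sum, sum_coord_sq, mul_one]
    simp only [h2]
    refine Finset.sum_le_sum fun i _ => ?_
    have h3 : h i x ^ 2 = (1 + 2 * t * F x) * (x : E3) i ^ 2 - 2 * t * c i * (x : E3) i
        + (t * (F x * (x : E3) i - c i)) ^ 2 := by
      simp only [hh]; ring
    rw [h3]
    exact le_add_of_nonneg_right (sq_nonneg _)
  have henergy : ∑ i, ∫ x in Ω, ‖tangentialGradient (h i) x‖ ^ 2 ∂area =
      2 * area.real Ω + 4 * t * ∫ x in Ω, F (x : E3) ∂area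
        + 2 * t ^ 2 * ∫ x in Ω, F (x : E3) ^ 2 ∂area
        + t ^ 2 * ∫ x in Ω, ‖tangentialGradient F x‖ ^ 2 ∂area := by
    rw [← integral_finsetSum _ fun i _ =>
      integrable_of_continuous (f := fun x : S2 => ‖tangentialGradient (h i) x‖ ^ 2)
        ((continuous_tangentialGradient (hsm i)).norm.pow 2)]
    have h1 : ∀ x : S2, ∑ i, ‖tangentialGradient (h i) x‖ ^ 2 =
        2 + 4 * t * F x + 2 * t ^ 2 * F x ^ 2 + t ^ 2 * ‖tangentialGradient F x‖ ^ 2 := fun x => by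
      rw [sum_norm_sq_tangentialGradient (hF.differentiable (by simp) _) t fun i => t * c i]
      ring
    simp_rw [h1]
    rw [integral_add (integrable_of_continuous (by fun_prop))
        (integrable_of_continuous (by fun_prop)),
      integral_add (integrable_of_continuous (by fun_prop))
        (integrable_of_continuous (by fun_prop)),
      integral_add (integrable_of_continuous (by fun_prop))
        (integrable_of_continuous (by fun_prop))]
    simp_rw [integral_const_mul]
    simp
    ring
  have hfin := (mul_le_mul_of_nonneg_left hlower
    (ENNReal.toReal_nonneg (a := eigenvalue Ω μ 1))).trans (hvar.trans_eq henergy)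
  linarith

theorem sq_pairing_le {Ω : Set S2} {μ : Measure S2} [IsFiniteMeasure μ]
    (hμ : μ (closure Ω)ᶜ = 0) (hbal : ∀ i, ∫ x : S2, (x : E3) i ∂μ = 0)
    {F : E3 → ℝ} (hF : ContDiff ℝ ∞ F) :
    ((eigenvalue Ω μ 1).toReal * ∫ x : S2, F x ∂μ - 2 * ∫ x in Ω, F (x : E3) ∂area) ^ 2 ≤
      (2 * area.real Ω - (eigenvalue Ω μ 1).toReal * μ.real Set.univ) *
        (2 * ∫ x in Ω, F (x : E3) ^ 2 ∂area
          + ∫ x in Ω, ‖tangentialGradient F x‖ ^ 2 ∂area) := by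
  have := discrim_le_zero (quadratic_nonneg_of_balanced hμ hbal hF)
  rw [discrim] at this
  linarith

/-- With `t = 0` the test functions are the coordinates themselves: this is Hersch's bound for the
balanced measure. -/
theorem defect_nonneg {Ω : Set S2} {μ : Measure S2} [IsFiniteMeasure μ]
    (hμ : μ (closure Ω)ᶜ = 0) (hbal : ∀ i, ∫ x : S2, (x : E3) i ∂μ = 0) :
    0 ≤ 2 * area.real Ω - (eigenvalue Ω μ 1).toReal * μ.real Set.univ := by
  simpa using quadratic_nonneg_of_balanced hμ hbal (contDiff_const (c := (0 : ℝ))) 0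

/-! ### Passage to the limit in the Sobolev space -/

theorem toReal_eLpNorm_two_sq {α E : Type*} [MeasurableSpace α] {μ : Measure α}
    [NormedAddCommGroup E] {f : α → E} (hf : MemLp f 2 μ) :
    (eLpNorm f 2 μ).toReal ^ 2 = ∫ x, ‖f x‖ ^ 2 ∂μ := by
  have h0 : 0 ≤ ∫ x, ‖f x‖ ^ 2 ∂μ := integral_nonneg fun _ => by positivity
  rw [hf.eLpNorm_eq_integral_rpow_norm (by simp) (by simp),
    ENNReal.toReal_ofReal (by positivity)]
  simp only [ENNReal.toReal_ofNat, Real.rpow_ofNat]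
  rw [← Real.rpow_natCast, ← Real.rpow_mul h0]
  norm_num

theorem tendsto_toReal_eLpNorm {α E : Type*} [MeasurableSpace α] {μ : Measure α}
    [NormedAddCommGroup E] {f : ℕ → α → E} {g : α → E} (hf : ∀ n, MemLp (f n) 2 μ)
    (hg : MemLp g 2 μ) (h : Tendsto (fun n => eLpNorm (fun x => f n x - g x) 2 μ) atTop (𝓝 0)) :
    Tendsto (fun n => (eLpNorm (f n) 2 μ).toReal) atTop (𝓝 (eLpNorm g 2 μ).toReal) := by
  have h1 := (Lp.tendsto_Lp_iff_tendsto_eLpNorm'' f hf g hg).mpr h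
  simpa only [Lp.norm_toLp] using h1.norm

theorem tendsto_integral_of_eLpNorm_two {α : Type*} [MeasurableSpace α] {μ : Measure α}
    [IsFiniteMeasure μ] {f : ℕ → α → ℝ} {g : α → ℝ} (hf : ∀ n, MemLp (f n) 2 μ)
    (hg : MemLp g 2 μ) (h : Tendsto (fun n => eLpNorm (fun x => f n x - g x) 2 μ) atTop (𝓝 0)) :
    Tendsto (fun n => ∫ x, f n x ∂μ) atTop (𝓝 (∫ x, g x ∂μ)) := by
  refine tendsto_integral_of_L1' g (hg.integrable one_le_two).aestronglyMeasurable
    (.of_forall fun n => (hf n).integrable one_le_two) ?_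
  have h1 : Tendsto (fun n => eLpNorm (fun x => f n x - g x) 2 μ
      * μ Set.univ ^ (1 / (1 : ℝ≥0∞).toReal - 1 / (2 : ℝ≥0∞).toReal)) atTop (𝓝 0) := by
    have := ENNReal.Tendsto.mul_const (b := μ Set.univ ^
      (1 / (1 : ℝ≥0∞).toReal - 1 / (2 : ℝ≥0∞).toReal)) h
      (Or.inr (ENNReal.rpow_ne_top_of_nonneg (by norm_num) (measure_ne_top _ _)))
    simpa using this
  refine tendsto_of_tendsto_of_tendsto_of_le_of_le tendsto_const_nhds h1 (fun _ => zero_le)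
    fun n => eLpNorm_le_eLpNorm_mul_rpow_measure_univ one_le_two
      ((hf n).sub hg).aestronglyMeasurable

/-- Both sides are continuous under the convergences in `approx`; finiteness of the measures turns
`L²` convergence into convergence of integrals. -/
theorem IsSobolev.sq_pairing_le {Ω : Set S2} {μ : Measure S2} [IsFiniteMeasure μ]
    (hμ : μ (closure Ω)ᶜ = 0) (hbal : ∀ i, ∫ x : S2, (x : E3) i ∂μ = 0)
    {φ : S2 → ℝ} {G : S2 → E3} {τ : S2 → ℝ} (hφ : IsSobolev Ω μ φ G τ) :
    ((eigenvalue Ω μ 1).toReal * ∫ x, τ x ∂μ - 2 * ∫ x in Ω, φ x ∂area) ^ 2 ≤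
      (2 * area.real Ω - (eigenvalue Ω μ 1).toReal * μ.real Set.univ) *
        (2 * (eLpNorm φ 2 (area.restrict Ω)).toReal ^ 2
          + (eLpNorm G 2 (area.restrict Ω)).toReal ^ 2) := by
  obtain ⟨F, hF, h1, h2, h3⟩ := hφ.approx
  have hFc : ∀ n, Continuous fun x : S2 => F n (x : E3) := fun n =>
    (hF n).continuous.comp continuous_subtype_val
  have hmF : ∀ n, MemLp (fun x : S2 => F n (x : E3)) 2 (area.restrict Ω) := fun n =>
    memLp_two_of_continuous (hFc n)
  have hmG : ∀ n, MemLp (tangentialGradient (F n)) 2 (area.restrict Ω) := fun n =>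
    memLp_two_of_continuous (continuous_tangentialGradient (hF n))
  have hmτ : ∀ n, MemLp (fun x : S2 => F n (x : E3)) 2 μ := fun n =>
    memLp_two_of_continuous (hFc n)
  have l1 := tendsto_toReal_eLpNorm hmF hφ.memLp h1
  have l2 := tendsto_toReal_eLpNorm hmG hφ.memLp_grad h2
  have l3 := tendsto_integral_of_eLpNorm_two hmτ hφ.memLp_trace h3
  have l4 := tendsto_integral_of_eLpNorm_two hmF hφ.memLp h1
  refine le_of_tendsto_of_tendsto' (((l3.const_mul _).sub (l4.const_mul 2)).pow 2)
    ((((l1.pow 2).const_mul 2).add (l2.pow 2)).const_mul _) fun n => ?_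
  rw [toReal_eLpNorm_two_sq (hmF n), toReal_eLpNorm_two_sq (hmG n)]
  simpa using SteklovSphere.sq_pairing_le hμ hbal (hF n)

theorem sobolevDualNorm_le {Ω : Set S2} {μ : Measure S2} [IsFiniteMeasure μ]
    (hμ : μ (closure Ω)ᶜ = 0) (hbal : ∀ i, ∫ x : S2, (x : E3) i ∂μ = 0) :
    sobolevDualNorm Ω μ (eigenvalue Ω μ 1).toReal 2 ≤ ENNReal.ofReal
      (√(2 * (2 * area.real Ω - (eigenvalue Ω μ 1).toReal * μ.real Set.univ))) := by
  refine iSup_le fun φ => iSup_le fun G => iSup_le fun τ => iSup_le fun ⟨hφ, hle⟩ => ?_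
  refine ENNReal.ofReal_le_ofReal (Real.abs_le_sqrt ((hφ.sq_pairing_le hμ hbal).trans ?_))
  have hS := defect_nonneg hμ hbal
  have hn : (eLpNorm φ 2 (area.restrict Ω)).toReal ^ 2
      + (eLpNorm G 2 (area.restrict Ω)).toReal ^ 2 ≤ 1 := by
    rw [← ENNReal.toReal_pow, ← ENNReal.toReal_pow, ← ENNReal.toReal_add
      (ENNReal.pow_ne_top hφ.memLp.eLpNorm_ne_top)
      (ENNReal.pow_ne_top hφ.memLp_grad.eLpNorm_ne_top)]
    exact ENNReal.toReal_le_of_le_ofReal zero_le_one (by simpa using hle)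
  rw [mul_comm 2 (_ - _)]
  refine mul_le_mul_of_nonneg_left ?_ hS
  -- `2‖φ‖² + ‖G‖² ≤ 2(‖φ‖² + ‖G‖²) ≤ 2`, the source of the factor `2` under the root.
  nlinarith [sq_nonneg (eLpNorm G 2 (area.restrict Ω)).toReal]

end SteklovSphere

theorem proposition5p3
    (Ω : Set SteklovSphere.S2) (hΩ : SteklovSphere.IsSmoothDomain Ω)
    (hbdry : (frontier Ω).Nonempty)
    (w : SteklovSphere.E3 → ℝ) (hw : ContDiff ℝ ∞ w)
    (hbal : ∫ x : SteklovSphere.S2, (x : SteklovSphere.E3)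
      ∂(SteklovSphere.boundaryLength Ω w) = 0) :
    SteklovSphere.sobolevDualNorm Ω (SteklovSphere.boundaryLength Ω w)
        (SteklovSphere.sigmaOne Ω w) 2 ≠ ⊤ ∧
      (SteklovSphere.sobolevDualNorm Ω (SteklovSphere.boundaryLength Ω w)
          (SteklovSphere.sigmaOne Ω w) 2).toReal ^ 2
        + 6 * SteklovSphere.area.real Ωᶜ
      ≤ 3 * (8 * Real.pi - SteklovSphere.sigmaOneBar Ω w) := by
  open SteklovSphere in
  have := hΩ.isFiniteMeasure_boundaryLength hw
  have hμ := boundaryLength_compl_closure Ω w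
  have hbal' : ∀ i, ∫ x : S2, (x : E3) i ∂(boundaryLength Ω w) = 0 := by
    intro i
    have h := (EuclideanSpace.proj i : E3 →L[ℝ] ℝ).integral_comp_comm
      (integrable_of_continuous (μ := boundaryLength Ω w)
        (continuous_subtype_val (p := fun x : E3 => x ∈ Metric.sphere (0 : E3) 1)))
    rw [hbal, map_zero] at h
    simpa using h
  have hle := sobolevDualNorm_le hμ hbal'
  have hS := defect_nonneg hμ hbal'
  have hA : area.real Ωᶜ = 4 * Real.pi - area.real Ω := by
    rw [measureReal_compl hΩ.isOpen.measurableSet, area_real_univ]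
  refine ⟨ne_top_of_le_ne_top ENNReal.ofReal_ne_top hle, ?_⟩
  have h1 := ENNReal.toReal_le_of_le_ofReal (Real.sqrt_nonneg _) hle
  have h2 := pow_le_pow_left₀ ENNReal.toReal_nonneg h1 2
  rw [Real.sq_sqrt (by positivity)] at h2
  rw [hA]
  simp only [sigmaOneBar, sigmaOne, totalLength] at *
  -- The bound `2S` is weakened to `3S` by `hS`; then `3S + 6(4π - Area(Ω))` is exactly the
  -- right-hand side.
  linarith
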